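/- Let $X$ be a strictly convex Banach space and let $K \subseteq X$ be a nonempty weakly compact convex set. For a nonempty bounded set $C \subseteq X$ and $x \in X$ put $r(x,C) = \sup\{\|x-y\| : y \in C\}$ and $\delta(C) = \sup\{\|z-y\| : z,y \in C\}$. Assume that $K$ has normal structure, i.e. every nonempty convex set $C \subseteq K$ with $\delta(C) > 0$ contains a point $x$ with $r(x,C) < \delta(C)$. Let $r(K) = \inf\{r(x,K) : x \in K\}$, and let $C(K) = \{x \in K : r(x,K) = r(K)\}$ be the Chebyshev center of $K$. A semigroup $S$ is called left reversible if for all $a,b \in S$ there are $c,d \in S$ with $ac = bd$. Let $\mathfrak{F}$ be a left reversible topological semigroup (a semigroup with a topology for which multiplication is continuous in each variable separately; jointly continuous multiplication is a special case) which acts on $K$, i.e. $(st)x = s(tx)$ for $s,t \in \mathfrak{F}$ and $x \in K$. Assume that for every $s \in \mathfrak{F}$ the map $x \mapsto sx$ is an isometry of $K$ into itself (not necessarily surjective), that the action is separately continuous, i.e. $(s,x) \mapsto sx$ is continuous in each variable for the norm topology on $K$, and that every sub-semigroup of $\mathfrak{F}$ is left reversible. Then $C(K)$ contains a common fixed point of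 $\mathfrak{F}$: there is $x_0 \in C(K)$ with $s x_0 = x_0$ for all $s \in \mathfrak{F}$. -/

import Mathlib

noncomputable section

/-- A semigroup is left reversible if any two principal right ideals meet:
for all `a, b` there are `c, d` with `a * c = b * d`. -/
def IsLeftReversible (S : Type*) [Semigroup S] : Prop :=
  ∀ a b : S, ∃ c d : S, a * c = b * d

/-- An action of `S` on `E` is separately continuous if `(s, x) ↦ s • x` is continuous
in each of the two variables. -/
def IsSeparatelyContinuousAction (S E : Type*) [TopologicalSpace S] [TopologicalSpace E]
    [SMul S E] : Prop :=
  (∀ x : E, Continuous fun s : S => s • x) ∧ (∀ s : S, Continuous fun x : E => s • x)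

section NormedSpaces

variable {X : Type*} [NormedAddCommGroup X] [NormedSpace ℝ X]

/-- `K` is compact in the weak topology of `X`. -/
def IsWeaklyCompact (K : Set X) : Prop :=
  IsCompact (toWeakSpace ℝ X '' K)

/-- `r(x, C) = sup {‖x - y‖ : y ∈ C}`; used for nonempty bounded sets `C`. -/
def radiusAt (x : X) (C : Set X) : ℝ :=
  sSup {t : ℝ | ∃ y ∈ C, t = ‖x - y‖}

/-- `δ(C) = sup {‖z - y‖ : z, y ∈ C}`; used for nonempty bounded sets `C`. -/
def setDiameter (C : Set X) : ℝ :=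
  sSup {t : ℝ | ∃ z ∈ C, ∃ y ∈ C, t = ‖z - y‖}

/-- Normal structure of a (nonempty bounded convex) set `K`: every nonempty convex `C ⊆ K`
with `δ(C) > 0` has a point `x ∈ C` such that `r(x, C) < δ(C)`. -/
def HasNormalStructure (K : Set X) : Prop :=
  ∀ C : Set X, C ⊆ K → C.Nonempty → Convex ℝ C → 0 < setDiameter C →
    ∃ x ∈ C, radiusAt x C < setDiameter C

/-- The Chebyshev radius `r(K) = inf {r(x, K) : x ∈ K}`. -/
def chebyshevRadius (K : Set X) : ℝ :=
  sInf {t : ℝ | ∃ x ∈ K, t = radiusAt x K}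

/-- The Chebyshev center `C(K) = {x ∈ K : r(x, K) = r(K)}`. -/
def chebyshevCenter (K : Set X) : Set X :=
  {x : X | x ∈ K ∧ radiusAt x K = chebyshevRadius K}

end NormedSpaces

end

open Set

/-! ### Metric facts on radii and asymptotic centers -/

section NormedGroup

variable {X : Type*} [NormedAddCommGroup X]

/-! Isometries that are not onto need not preserve C(K), so C(K) is replaced by `asymptoticCenter`,
the points z whose balls of radius r(K) + ε each contain some image sK. This set is closed, convex
and invariant, and contains s(C(K)) for every s. On it a fixed point z exists: strict convexity
makes isometries affine, hence a minimal invariant set M satisfies sM = M, and normal structure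
makes M a point. Finally ‖z - y‖ = ‖sz - sy‖ = ‖z - sy‖ ≤ r(K) + ε for all y in K, so z lies in
C(K). -/

theorem radiusAt_le {K : Set X} (hne : K.Nonempty) {x : X} {t : ℝ}
    (h : ∀ y ∈ K, ‖x - y‖ ≤ t) : radiusAt x K ≤ t := by
  obtain ⟨y, hy⟩ := hne
  refine csSup_le ⟨_, y, hy, rfl⟩ ?_
  rintro _ ⟨z, hz, rfl⟩
  exact h z hz

theorem chebyshevRadius_le_radiusAt {K : Set X} {x : X} (hx : x ∈ K) :
    chebyshevRadius K ≤ radiusAt x K := by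
  refine csInf_le ⟨0, ?_⟩ ⟨x, hx, rfl⟩
  rintro _ ⟨z, -, rfl⟩
  refine Real.sSup_nonneg ?_
  rintro _ ⟨y, -, rfl⟩
  exact norm_nonneg _

theorem mem_chebyshevCenter_of_norm_sub_le {K : Set X} {x : X} (hx : x ∈ K)
    (h : ∀ y ∈ K, ‖x - y‖ ≤ chebyshevRadius K) : x ∈ chebyshevCenter K :=
  ⟨hx, le_antisymm (radiusAt_le ⟨x, hx⟩ h) (chebyshevRadius_le_radiusAt hx)⟩

theorem isClosed_setOf_forall_norm_sub_le (C : Set X) (t : ℝ) :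
    IsClosed {x : X | ∀ y ∈ C, ‖x - y‖ ≤ t} := by
  simp only [ofPred_forall]
  exact isClosed_biInter fun y _ => isClosed_le (by fun_prop) continuous_const

theorem IsClosed.image_of_dist_eq [CompleteSpace X] {C : Set X} (hC : IsClosed C) {f : X → X}
    (hf : ∀ x ∈ C, ∀ y ∈ C, dist (f x) (f y) = dist x y) : IsClosed (f '' C) := by
  have hiso : Isometry fun x : C => f x := Isometry.of_dist_eq fun x y => hf x x.2 y y.2
  have : CompleteSpace C := hC.completeSpace_coe
  have h := hiso.isClosedEmbedding.isClosed_range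
  rwa [show range (fun x : C => f x) = f '' C by rw [image_eq_range]] at h

/-- The points whose asymptotic radius along the images of `K` is at most the Chebyshev radius. -/
def asymptoticCenter {S : Type*} (f : S → X → X) (K : Set X) : Set X :=
  {z | z ∈ K ∧ ∀ ε : ℝ, 0 < ε → ∃ s, ∀ y ∈ K, ‖z - f s y‖ ≤ chebyshevRadius K + ε}

theorem isClosed_asymptoticCenter {S : Type*} {f : S → X → X} {K : Set X} (hK : IsClosed K) :
    IsClosed (asymptoticCenter f K) := by
  refine isClosed_of_closure_subset fun z hz => ⟨?_, fun ε hε => ?_⟩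
  · exact hK.closure_subset_iff.2 (fun x hx => hx.1) hz
  · obtain ⟨w, hw, hzw⟩ := Metric.mem_closure_iff.1 hz (ε / 2) (half_pos hε)
    obtain ⟨s, hs⟩ := hw.2 (ε / 2) (half_pos hε)
    refine ⟨s, fun y hy => ?_⟩
    have h := norm_sub_le_norm_sub_add_norm_sub z w (f s y)
    rw [dist_eq_norm] at hzw
    linarith [hs y hy]

end NormedGroup

/-! ### Weak compactness and Chebyshev centers -/

section WeaklyCompactConvex

variable {X : Type*} [NormedAddCommGroup X] [NormedSpace ℝ X]

theorem Convex.isClosed_toWeakSpace_image {C : Set X} (hC : Convex ℝ C) (hcl : IsClosed C) :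
    IsClosed (toWeakSpace ℝ X '' C) := by
  have h := hC.toWeakSpace_closure (𝕜 := ℝ)
  rw [hcl.closure_eq] at h
  rw [h]
  exact isClosed_closure

theorem IsWeaklyCompact.of_isClosed_convex_subset {K C : Set X} (hK : IsWeaklyCompact K)
    (hCK : C ⊆ K) (hcl : IsClosed C) (hC : Convex ℝ C) : IsWeaklyCompact C :=
  IsCompact.of_isClosed_subset hK (hC.isClosed_toWeakSpace_image hcl) (image_mono hCK)

theorem IsWeaklyCompact.isClosed {K : Set X} (hK : IsWeaklyCompact K) : IsClosed K := by
  have h := (IsCompact.isClosed hK).preimage (toWeakSpaceCLM ℝ X).continuous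
  convert h using 1
  exact (preimage_image_eq K (toWeakSpace ℝ X).injective).symm

/-- Each functional is bounded on K, so uniform boundedness applies to K embedded isometrically in
the bidual. -/
theorem IsWeaklyCompact.exists_norm_le {K : Set X} (hK : IsWeaklyCompact K) :
    ∃ B : ℝ, ∀ x ∈ K, ‖x‖ ≤ B := by
  obtain ⟨B, hB⟩ := banach_steinhaus
    (g := fun x : K => NormedSpace.inclusionInDoubleDual ℝ X (x : X)) (by
      intro f
      have hf : Continuous fun w : WeakSpace ℝ X => f ((toWeakSpace ℝ X).symm w) :=
        WeakBilin.eval_continuous (topDualPairing ℝ X).flip f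
      obtain ⟨B, hB⟩ := (IsCompact.image hK hf).isBounded.exists_norm_le
      exact ⟨B, fun x => hB _ ⟨_, mem_image_of_mem _ x.2, rfl⟩⟩)
  refine ⟨B, fun x hx => ?_⟩
  have h := hB ⟨x, hx⟩
  rwa [show ‖NormedSpace.inclusionInDoubleDual ℝ X x‖ = ‖x‖ from
    (NormedSpace.inclusionInDoubleDualLi ℝ (E := X)).norm_map x] at h

/-- A downward directed family of nonempty closed convex subsets of a weakly compact set
has a common point. -/
theorem IsWeaklyCompact.nonempty_iInter_of_directed {K : Set X} (hK : IsWeaklyCompact K)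
    {ι : Type*} [Nonempty ι] (C : ι → Set X) (hdir : Directed (· ⊇ ·) C)
    (hCK : ∀ i, C i ⊆ K) (hne : ∀ i, (C i).Nonempty) (hcl : ∀ i, IsClosed (C i))
    (hconv : ∀ i, Convex ℝ (C i)) : (⋂ i, C i).Nonempty := by
  obtain ⟨w, hw⟩ := IsCompact.nonempty_iInter_of_directed_nonempty_isCompact_isClosed
    (fun i => toWeakSpace ℝ X '' C i)
    (fun i j => (hdir i j).imp fun k hk => ⟨image_mono hk.1, image_mono hk.2⟩)
    (fun i => (hne i).image _)
    (fun i => hK.of_isClosed_convex_subset (hCK i) (hcl i) (hconv i))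
    (fun i => (hconv i).isClosed_toWeakSpace_image (hcl i))
  refine ⟨(toWeakSpace ℝ X).symm w, mem_iInter.2 fun i => ?_⟩
  obtain ⟨x, hx, rfl⟩ := mem_iInter.1 hw i
  simpa using hx

theorem IsWeaklyCompact.bddAbove_radius {K : Set X} (hK : IsWeaklyCompact K) (x : X) :
    BddAbove {t : ℝ | ∃ y ∈ K, t = ‖x - y‖} := by
  obtain ⟨B, hB⟩ := hK.exists_norm_le
  refine ⟨‖x‖ + B, ?_⟩
  rintro _ ⟨y, hy, rfl⟩
  exact (norm_sub_le x y).trans (by gcongr; exact hB y hy)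

theorem IsWeaklyCompact.bddAbove_diameter {K : Set X} (hK : IsWeaklyCompact K) :
    BddAbove {t : ℝ | ∃ z ∈ K, ∃ y ∈ K, t = ‖z - y‖} := by
  obtain ⟨B, hB⟩ := hK.exists_norm_le
  refine ⟨B + B, ?_⟩
  rintro _ ⟨z, hz, y, hy, rfl⟩
  exact (norm_sub_le z y).trans (add_le_add (hB z hz) (hB y hy))

theorem IsWeaklyCompact.norm_sub_le_radiusAt {K : Set X} (hK : IsWeaklyCompact K) (x : X)
    {y : X} (hy : y ∈ K) : ‖x - y‖ ≤ radiusAt x K :=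
  le_csSup (hK.bddAbove_radius x) ⟨y, hy, rfl⟩

theorem convex_setOf_forall_norm_sub_le (C : Set X) (t : ℝ) :
    Convex ℝ {x : X | ∀ y ∈ C, ‖x - y‖ ≤ t} := by
  simp only [ofPred_forall]
  refine convex_iInter₂ fun y _ => ?_
  convert convex_closedBall y t using 1
  ext x
  simp [dist_eq_norm]

theorem IsWeaklyCompact.nonempty_chebyshevCenter {K : Set X} (hK : IsWeaklyCompact K)
    (hconv : Convex ℝ K) (hne : K.Nonempty) : (chebyshevCenter K).Nonempty := by
  have : Nonempty {ε : ℝ // 0 < ε} := ⟨⟨1, one_pos⟩⟩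
  obtain ⟨x, hx⟩ := hK.nonempty_iInter_of_directed
    (fun ε : {ε : ℝ // 0 < ε} =>
      K ∩ {x : X | ∀ y ∈ K, ‖x - y‖ ≤ chebyshevRadius K + ε.1})
    (fun a b => ⟨⟨min a.1 b.1, lt_min a.2 b.2⟩,
      fun x hx => ⟨hx.1, fun y hy => (hx.2 y hy).trans (by gcongr; exact min_le_left _ _)⟩,
      fun x hx => ⟨hx.1, fun y hy => (hx.2 y hy).trans (by gcongr; exact min_le_right _ _)⟩⟩)
    (fun _ => inter_subset_left)
    (fun ε => by
      obtain ⟨x₀, hx₀⟩ := hne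
      obtain ⟨_, ⟨x, hx, rfl⟩, hlt⟩ := exists_lt_of_csInf_lt
        (s := {t : ℝ | ∃ x ∈ K, t = radiusAt x K}) ⟨_, x₀, hx₀, rfl⟩
        (lt_add_of_pos_right (chebyshevRadius K) ε.2)
      exact ⟨x, hx, fun y hy => (hK.norm_sub_le_radiusAt x hy).trans hlt.le⟩)
    (fun _ => hK.isClosed.inter (isClosed_setOf_forall_norm_sub_le _ _))
    (fun _ => hconv.inter (convex_setOf_forall_norm_sub_le _ _))
  simp only [mem_iInter] at hx
  exact ⟨x, mem_chebyshevCenter_of_norm_sub_le (hx ⟨1, one_pos⟩).1 fun y hy =>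
    le_of_forall_pos_le_add fun ε hε => (hx ⟨ε, hε⟩).2 y hy⟩

theorem HasNormalStructure.mono {K C : Set X} (hK : HasNormalStructure K) (hCK : C ⊆ K) :
    HasNormalStructure C :=
  fun D hD => hK D (hD.trans hCK)

end WeaklyCompactConvex

/-! ### Semigroups of isometries and fixed points -/

section Isometries

variable {X : Type*} [NormedAddCommGroup X] [NormedSpace ℝ X]

/-- An isometric map of a convex set into a strictly convex space is affine. -/
theorem Convex.map_combo_of_dist_eq [StrictConvexSpace ℝ X] {K : Set X} (hK : Convex ℝ K)
    {f : X → X} (hf : ∀ x ∈ K, ∀ y ∈ K, dist (f x) (f y) = dist x y)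
    {x y : X} (hx : x ∈ K) (hy : y ∈ K) {a b : ℝ} (ha : 0 ≤ a) (hb : 0 ≤ b) (hab : a + b = 1) :
    f (a • x + b • y) = a • f x + b • f y := by
  have hz : a • x + b • y ∈ K := hK hx hy ha hb hab
  have hline : ∀ u v : X, AffineMap.lineMap u v b = a • u + b • v := fun u v => by
    rw [AffineMap.lineMap_apply_module, ← hab, add_sub_cancel_right]
  rw [← hline (f x) (f y)]
  have ha' : a = 1 - b := by linarith
  apply eq_lineMap_of_dist_eq_mul_of_dist_eq_mul
  · rw [hf x hx _ hz, hf x hx y hy, ← hline x y, dist_left_lineMap, Real.norm_of_nonneg hb]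
  · rw [hf _ hz y hy, hf x hx y hy, ← hline x y, dist_lineMap_right, ← ha',
      Real.norm_of_nonneg ha]

theorem Convex.image_of_dist_eq [StrictConvexSpace ℝ X] {C : Set X} (hC : Convex ℝ C)
    {f : X → X} (hf : ∀ x ∈ C, ∀ y ∈ C, dist (f x) (f y) = dist x y) :
    Convex ℝ (f '' C) := by
  rintro _ ⟨x, hx, rfl⟩ _ ⟨y, hy, rfl⟩ a b ha hb hab
  exact ⟨_, hC hx hy ha hb hab, hC.map_combo_of_dist_eq hf hx hy ha hb hab⟩

/-- If s serves x and t serves y, a common multiple sc = td serves both, since its image of K lies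
in sK ∩ tK. -/
theorem convex_asymptoticCenter {S : Type*} [Semigroup S] (hrev : IsLeftReversible S)
    {f : S → X → X} {K : Set X}
    (hconv : Convex ℝ K) (hmaps : ∀ s, MapsTo (f s) K K)
    (hmul : ∀ s t, ∀ x ∈ K, f (s * t) x = f s (f t x)) :
    Convex ℝ (asymptoticCenter f K) := by
  rintro x ⟨hx, hxr⟩ y ⟨hy, hyr⟩ a b ha hb hab
  refine ⟨hconv hx hy ha hb hab, fun ε hε => ?_⟩
  obtain ⟨s, hs⟩ := hxr ε hε
  obtain ⟨t, ht⟩ := hyr ε hε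
  obtain ⟨c, d, h⟩ := hrev s t
  refine ⟨s * c, fun w hw => ?_⟩
  have h1 : ‖x - f (s * c) w‖ ≤ chebyshevRadius K + ε := by
    rw [hmul s c w hw]
    exact hs _ (hmaps c hw)
  have h2 : ‖y - f (s * c) w‖ ≤ chebyshevRadius K + ε := by
    rw [h, hmul t d w hw]
    exact ht _ (hmaps d hw)
  have hball := convex_closedBall (f (s * c) w) (chebyshevRadius K + ε)
    (mem_closedBall_iff_norm.2 h1) (mem_closedBall_iff_norm.2 h2) ha hb hab
  exact mem_closedBall_iff_norm.1 hball

theorem exists_minimal_invariant {S : Type*} {f : S → X → X} {K : Set X} (hK : IsWeaklyCompact K)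
    (hne : K.Nonempty) (hconv : Convex ℝ K) (hmaps : ∀ s, MapsTo (f s) K K) :
    ∃ M, Minimal (fun C : Set X => C ⊆ K ∧ C.Nonempty ∧ IsClosed C ∧ Convex ℝ C ∧
      ∀ s, MapsTo (f s) C C) M := by
  obtain ⟨M, -, hM⟩ := zorn_superset_nonempty
    {C : Set X | C ⊆ K ∧ C.Nonempty ∧ IsClosed C ∧ Convex ℝ C ∧ ∀ s, MapsTo (f s) C C}
    (fun c hc hchain hcne => by
      have := hcne.to_subtype
      obtain ⟨C₀, hC₀⟩ := hcne
      refine ⟨⋂₀ c, ⟨(sInter_subset_of_mem hC₀).trans (hc hC₀).1, ?_,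
        isClosed_sInter fun C hC => (hc hC).2.2.1, convex_sInter fun C hC => (hc hC).2.2.2.1,
        fun s x hx C hC => (hc hC).2.2.2.2 s (hx C hC)⟩, fun C hC => sInter_subset_of_mem hC⟩
      rw [sInter_eq_iInter]
      exact hK.nonempty_iInter_of_directed _
        (DirectedOn.directed_val (IsChain.directedOn hchain.symm))
        (fun C => (hc C.2).1) (fun C => (hc C.2).2.1) (fun C => (hc C.2).2.2.1)
        (fun C => (hc C.2).2.2.2.1))
    K ⟨Subset.rfl, hne, hK.isClosed, hconv, hmaps⟩
  exact ⟨M, hM⟩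

variable [CompleteSpace X] [StrictConvexSpace ℝ X] {S : Type*} [Semigroup S]

/-- A minimal nonempty closed convex invariant set is mapped onto itself by every element of a
left reversible semigroup of isometries. -/
theorem image_eq_of_minimal_invariant (hrev : IsLeftReversible S) {f : S → X → X} {K M : Set X}
    (hK : IsWeaklyCompact K) (hMK : M ⊆ K)
    (hdist : ∀ s, ∀ x ∈ K, ∀ y ∈ K, dist (f s x) (f s y) = dist x y)
    (hmul : ∀ s t, ∀ x ∈ K, f (s * t) x = f s (f t x))
    (hM : Minimal (fun C : Set X => C ⊆ K ∧ C.Nonempty ∧ IsClosed C ∧ Convex ℝ C ∧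
      ∀ s, MapsTo (f s) C C) M) (s : S) : f s '' M = M := by
  obtain ⟨-, hne, hcl, hconv, hinv⟩ := hM.prop
  have hd : ∀ s, ∀ x ∈ M, ∀ y ∈ M, dist (f s x) (f s y) = dist x y :=
    fun s x hx y hy => hdist s x (hMK hx) y (hMK hy)
  have hsub : ∀ s t, f (s * t) '' M ⊆ f s '' M := by
    rintro s t _ ⟨x, hx, rfl⟩
    exact ⟨f t x, hinv t hx, (hmul s t x (hMK hx)).symm⟩
  have : Nonempty S := ⟨s⟩
  have hI : (⋂ s, f s '' M) ⊆ M := fun x hx => (hinv s).image_subset (mem_iInter.1 hx s)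
  have hle : M ⊆ ⋂ s, f s '' M := by
    refine hM.le_of_le ⟨hI.trans hMK, ?_, isClosed_iInter fun s => hcl.image_of_dist_eq (hd s),
      convex_iInter fun s => hconv.image_of_dist_eq (hd s), ?_⟩ hI
    · refine hK.nonempty_iInter_of_directed _ (fun a b => ?_)
        (fun s => (hinv s).image_subset.trans hMK) (fun s => hne.image _)
        (fun s => hcl.image_of_dist_eq (hd s)) (fun s => hconv.image_of_dist_eq (hd s))
      obtain ⟨c, d, h⟩ := hrev a b
      exact ⟨a * c, hsub a c, h ▸ hsub b d⟩
    -- With tc = sd and x = cy, tx = (tc)y = s(dy) lies in sM.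
    · intro t x hx
      refine mem_iInter.2 fun s => ?_
      obtain ⟨c, d, h⟩ := hrev t s
      obtain ⟨y, hy, rfl⟩ := mem_iInter.1 hx c
      rw [← hmul t c y (hMK hy), h]
      exact hsub s d ⟨y, hy, rfl⟩
  exact (hinv s).image_subset.antisymm fun x hx => mem_iInter.1 (hle hx) s

/-- A left reversible semigroup of isometries of a weakly compact convex set with normal
structure has a common fixed point. -/
theorem exists_common_fixed_point_of_isLeftReversible (hrev : IsLeftReversible S)
    {f : S → X → X} {K : Set X} (hK : IsWeaklyCompact K) (hne : K.Nonempty)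
    (hconv : Convex ℝ K) (hns : HasNormalStructure K) (hmaps : ∀ s, MapsTo (f s) K K)
    (hdist : ∀ s, ∀ x ∈ K, ∀ y ∈ K, dist (f s x) (f s y) = dist x y)
    (hmul : ∀ s t, ∀ x ∈ K, f (s * t) x = f s (f t x)) :
    ∃ x ∈ K, ∀ s, f s x = x := by
  obtain ⟨M, hM⟩ := exists_minimal_invariant hK hne hconv hmaps
  obtain ⟨hMK, hMne, hMcl, hMconv, hMinv⟩ := hM.prop
  have hMc : IsWeaklyCompact M := hK.of_isClosed_convex_subset hMK hMcl hMconv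
  have hdiam : setDiameter M ≤ 0 := by
    by_contra! hpos
    obtain ⟨x₀, hx₀, hlt⟩ := hns M hMK hMne hMconv hpos
    have hle : M ⊆ M ∩ {x | ∀ y ∈ M, ‖x - y‖ ≤ radiusAt x₀ M} := by
      refine hM.le_of_le ⟨inter_subset_left.trans hMK,
        ⟨x₀, hx₀, fun y hy => hMc.norm_sub_le_radiusAt x₀ hy⟩,
        hMcl.inter (isClosed_setOf_forall_norm_sub_le _ _),
        hMconv.inter (convex_setOf_forall_norm_sub_le _ _), ?_⟩ inter_subset_left
      rintro s x ⟨hx, hxr⟩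
      refine ⟨hMinv s hx, fun y hy => ?_⟩
      -- Since sM = M, every y in M is some sz, and ‖sx - sz‖ = ‖x - z‖.
      rw [← image_eq_of_minimal_invariant hrev hK hMK hdist hmul hM s] at hy
      obtain ⟨z, hz, rfl⟩ := hy
      rw [← dist_eq_norm, hdist s x (hMK hx) z (hMK hz), dist_eq_norm]
      exact hxr z hz
    refine hlt.not_ge (csSup_le ⟨_, x₀, hx₀, x₀, hx₀, rfl⟩ ?_)
    rintro _ ⟨z, hz, y, hy, rfl⟩
    exact (hle hz).2 y hy
  obtain ⟨x, hx⟩ := hMne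
  refine ⟨x, hMK hx, fun s => ?_⟩
  have h : ‖f s x - x‖ ≤ setDiameter M :=
    le_csSup hMc.bddAbove_diameter ⟨_, hMinv s hx, x, hx, rfl⟩
  exact sub_eq_zero.1 (norm_le_zero_iff.1 (h.trans hdiam))

theorem exists_fixed_point_mem_chebyshevCenter (hrev : IsLeftReversible S)
    {f : S → X → X} {K : Set X} (hK : IsWeaklyCompact K) (hne : K.Nonempty)
    (hconv : Convex ℝ K) (hns : HasNormalStructure K) (hmaps : ∀ s, MapsTo (f s) K K)
    (hdist : ∀ s, ∀ x ∈ K, ∀ y ∈ K, dist (f s x) (f s y) = dist x y)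
    (hmul : ∀ s t, ∀ x ∈ K, f (s * t) x = f s (f t x)) :
    ∃ x ∈ chebyshevCenter K, ∀ s, f s x = x := by
  obtain ⟨x₀, hx₀, hx₀r⟩ := hK.nonempty_chebyshevCenter hconv hne
  rcases isEmpty_or_nonempty S with hS | ⟨⟨s₀⟩⟩
  · exact ⟨x₀, ⟨hx₀, hx₀r⟩, fun s => hS.elim s⟩
  have hsub : asymptoticCenter f K ⊆ K := fun x hx => hx.1
  have hcl := isClosed_asymptoticCenter (f := f) hK.isClosed
  have hcv := convex_asymptoticCenter hrev hconv hmaps hmul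
  obtain ⟨z, ⟨hz, hzr⟩, hfix⟩ := exists_common_fixed_point_of_isLeftReversible hrev (f := f)
    (hK.of_isClosed_convex_subset hsub hcl hcv)
    -- For a Chebyshev center x₀, the single element s₀ works for every ε.
    ⟨f s₀ x₀, hmaps s₀ hx₀, fun ε hε => ⟨s₀, fun y hy => by
      rw [← dist_eq_norm, hdist s₀ x₀ hx₀ y hy, dist_eq_norm]
      linarith [hK.norm_sub_le_radiusAt x₀ hy]⟩⟩ hcv (hns.mono hsub)
    (fun t x hx => ⟨hmaps t hx.1, fun ε hε => by
      obtain ⟨s, hs⟩ := hx.2 ε hε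
      refine ⟨t * s, fun y hy => ?_⟩
      rw [hmul t s y hy, ← dist_eq_norm, hdist t x hx.1 _ (hmaps s hy), dist_eq_norm]
      exact hs y hy⟩)
    (fun s x hx y hy => hdist s x hx.1 y hy.1) (fun s t x hx => hmul s t x hx.1)
  refine ⟨z, mem_chebyshevCenter_of_norm_sub_le hz fun y hy =>
    le_of_forall_pos_le_add fun ε hε => ?_, hfix⟩
  obtain ⟨s, hs⟩ := hzr ε hε
  have h := hs y hy
  have hzs : ‖f s z - f s y‖ = ‖z - y‖ := by
    rw [← dist_eq_norm, hdist s z hz y hy, dist_eq_norm]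
  rw [hfix s] at hzs
  exact hzs ▸ h

end Isometries

theorem mainTheorem2
    {X : Type*} [NormedAddCommGroup X] [NormedSpace ℝ X] [CompleteSpace X]
    [StrictConvexSpace ℝ X]
    (K : Set X) (hne : K.Nonempty) (hconv : Convex ℝ K) (hcomp : IsWeaklyCompact K)
    (hns : HasNormalStructure K)
    {S : Type*} [Semigroup S] [TopologicalSpace S] [SeparatelyContinuousMul S]
    [SemigroupAction S K]
    (hiso : ∀ s : S, Isometry fun x : K => s • x)
    (hcont : IsSeparatelyContinuousAction S K)
    (hrev : IsLeftReversible S)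
    (hsub : ∀ H : Subsemigroup S, IsLeftReversible H) :
    ∃ x : K, (x : X) ∈ chebyshevCenter K ∧ ∀ s : S, s • x = x := by
  classical
  -- The value off K is arbitrary: all conditions on f concern points of K.
  let f : S → X → X := fun s x => if h : x ∈ K then ((s • (⟨x, h⟩ : K) : K) : X) else x
  have hf : ∀ (s : S) (x : K), f s x = ((s • x : K) : X) := fun s x => dif_pos x.2
  obtain ⟨x, hx, hfix⟩ := exists_fixed_point_mem_chebyshevCenter hrev (f := f) hcomp hne hconv hns
    (fun s x hx => by
      rw [hf s ⟨x, hx⟩]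
      exact (s • (⟨x, hx⟩ : K)).2)
    (fun s x hx y hy => by
      rw [hf s ⟨x, hx⟩, hf s ⟨y, hy⟩]
      exact (hiso s).dist_eq ⟨x, hx⟩ ⟨y, hy⟩)
    (fun s t x hx => by rw [hf t ⟨x, hx⟩, hf s, hf (s * t) ⟨x, hx⟩, mul_smul])
  exact ⟨⟨x, hx.1⟩, hx, fun s => Subtype.ext ((hf s ⟨x, hx.1⟩).symm.trans (hfix s))⟩
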